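/- Let $K$ be a totally real number field with ring of integers $\mathbb Z_K$, and let $Q$ be a totally definite quaternion algebra over $K$, that is, $Q=\left(\frac{-a,-b}{K}\right)$ has a $K$-basis $(1,i,j,ij)$ with $i^2=-a$, $j^2=-b$, $ij=-ji$ for some totally positive $a,b\in K$. Let $\overline{\phantom{x}}$ be the canonical involution of $Q$, given by $\overline{t+xi+yj+zij}=t-xi-yj-zij$, and let $n(\alpha)=\alpha\overline{\alpha}$ be the reduced norm, a quadratic form on $Q$ over $K$. A $\mathbb Z_K$-lattice in $Q$ is a finitely generated $\mathbb Z_K$-submodule of $Q$ that contains a $K$-basis of $Q$. An order in $Q$ is a $\mathbb Z_K$-lattice that is a (unital) subring of $Q$; it is maximal if it is not contained in any other order. A $\mathbb Z_K$-lattice $J$ in $Q$ is normal if its right order $O_r(J)=\{\alpha\in Q\mid J\alpha\subseteq J\}$ is a maximal order. The norm of $J$ is $n(J)=\sum_{\gamma\in J}\mathbb Z_K\,n(\gamma)$. For a fractional ideal $\mathfrak a$ of $\mathbb Z_K$, the lattice $(J,n)$ in $(Q,n)$ is $\mathfrak a$-maximal if $n(\gamma)\in\mathfrak a$ for all $\gamma\in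 J$, and no $\mathbb Z_K$-lattice $L'$ in $Q$ with $J\subsetneq L'$ satisfies $n(\gamma)\in\mathfrak a$ for all $\gamma\in L'$. Let $\mathcal G_{\mathfrak a}(Q,n)$ be the set of all $\mathfrak a$-maximal lattices in $(Q,n)$. Let $J$ be a $\mathbb Z_K$-lattice in $Q$ and let $\mathfrak a$ be a fractional ideal of $\mathbb Z_K$. Then $J$ is a normal lattice in $Q$ with $n(J)=\mathfrak a$ if and only if $(J,n)$ lies in $\mathcal G_{\mathfrak a}(Q,n)$. -/

import Mathlib

open scoped NumberField Quaternion nonZeroDivisors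

/-- An element of a number field is totally positive if it is positive under every
real embedding. (Used only for totally real fields, all of whose infinite places are real.) -/
def IsTotallyPositive {K : Type*} [Field K] (a : K) : Prop :=
  ∀ σ : K →+* ℝ, 0 < σ a

section QuadraticLattices

variable {K : Type*} [Field K] {V : Type*} [AddCommGroup V] [Module K V]
  [Module (𝓞 K) V] [IsScalarTower (𝓞 K) K V]

/-- The `ℤ_K`-lattice `L` in the quadratic space `(V, q)` is `𝔞`-maximal: `q(L) ⊆ 𝔞`, and
`q(L') ⊆ 𝔞` fails for every `ℤ_K`-lattice `L'` in `V` that strictly contains `L`. -/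
def IsMaximalLattice (q : QuadraticForm K V) (𝔞 : FractionalIdeal (𝓞 K)⁰ K)
    (L : Submodule (𝓞 K) V) : Prop :=
  L.IsLattice K ∧ (∀ x ∈ L, q x ∈ 𝔞) ∧
    ∀ L' : Submodule (𝓞 K) V, L'.IsLattice K → L < L' → ¬ ∀ x ∈ L', q x ∈ 𝔞

/-- `𝒢_𝔞(V, q)`, the set of all `𝔞`-maximal lattices in `(V, q)`. -/
def maximalLattices (q : QuadraticForm K V) (𝔞 : FractionalIdeal (𝓞 K)⁰ K) :
    Set (Submodule (𝓞 K) V) :=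
  {L | IsMaximalLattice q 𝔞 L}

/-- The norm of a lattice `L` in `(V, q)`: the `ℤ_K`-submodule of `K` generated by all
values `q x` with `x ∈ L`. -/
def latticeNorm (q : QuadraticForm K V) (L : Submodule (𝓞 K) V) : Submodule (𝓞 K) K :=
  Submodule.span (𝓞 K) (q '' (L : Set V))

end QuadraticLattices

section Orders

variable {K : Type*} [Field K] {Q : Type*} [Ring Q] [Algebra K Q]
  [Algebra (𝓞 K) Q] [IsScalarTower (𝓞 K) K Q]

/-- An order in `Q`: a subring which is a `ℤ_K`-lattice in `Q`. (A subring that is also a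
`ℤ_K`-submodule is the same as a `ℤ_K`-subalgebra.) -/
def IsOrder (O : Subalgebra (𝓞 K) Q) : Prop :=
  (Subalgebra.toSubmodule O).IsLattice K

/-- An order in `Q` is maximal if it is not contained in any other order. -/
def IsMaximalOrder (O : Subalgebra (𝓞 K) Q) : Prop :=
  IsOrder O ∧ ∀ O' : Subalgebra (𝓞 K) Q, IsOrder O' → O ≤ O' → O' = O

/-- The right order `O_r(J) = {α ∈ Q | J α ⊆ J}`. -/
def rightOrder (J : Submodule (𝓞 K) Q) : Subalgebra (𝓞 K) Q where
  carrier := {α | ∀ x ∈ J, x * α ∈ J}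
  mul_mem' := fun {α β} hα hβ x hx => by
    rw [← mul_assoc]
    exact hβ _ (hα x hx)
  add_mem' := fun {α β} hα hβ x hx => by
    rw [mul_add]
    exact J.add_mem (hα x hx) (hβ x hx)
  algebraMap_mem' := fun r x hx => by
    rw [← Algebra.commutes, ← Algebra.smul_def]
    exact J.smul_mem r hx

/-- A `ℤ_K`-lattice in `Q` is normal if its right order is a maximal order. -/
def IsNormalLattice (J : Submodule (𝓞 K) Q) : Prop :=
  J.IsLattice K ∧ IsMaximalOrder (rightOrder J)

end Orders

section ReducedNorm

variable {K : Type*} [Field K]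

/-- The reduced norm `n(α) = α * ᾱ` of the quaternion algebra `(c₁, c₂ / K)` with basis
`1, i, j, ij`, `i² = c₁`, `j² = c₂`, `ij = -ji`, as a quadratic form over `K`. The canonical
involution is `star`; since `α * star α` lies in `K`, it is identified with its
`1`-coordinate, see `coe_reducedNorm`. -/
def reducedNorm (c₁ c₂ : K) : QuadraticForm K ℍ[K, c₁, c₂] where
  toFun α := (α * star α).re
  toFun_smul r α := by
    simp only [QuaternionAlgebra.re_mul, QuaternionAlgebra.re_smul, QuaternionAlgebra.imI_smul,
      QuaternionAlgebra.imJ_smul, QuaternionAlgebra.imK_smul, QuaternionAlgebra.re_star,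
      QuaternionAlgebra.imI_star, QuaternionAlgebra.imJ_star, QuaternionAlgebra.imK_star,
      smul_eq_mul]
    ring
  exists_companion' :=
    ⟨LinearMap.mk₂ K (fun α β => (α * star β + β * star α).re)
      (fun α α' β => by simp [add_mul, mul_add]; ring)
      (fun r α β => by simp; ring)
      (fun α β β' => by simp [add_mul, mul_add]; ring)
      (fun r α β => by simp; ring),
     fun α β => by simp [LinearMap.mk₂_apply]; ring⟩

theorem coe_reducedNorm (c₁ c₂ : K) (α : ℍ[K, c₁, c₂]) :
    ((reducedNorm c₁ c₂ α : K) : ℍ[K, c₁, c₂]) = α * star α := by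
  change (((α * star α).re : K) : ℍ[K, c₁, c₂]) = α * star α
  ext <;> simp <;> ring

end ReducedNorm

/-!
The proof is global and uses no structure theory of the completions. It works for every algebra `Q`
of dimension greater than `2` with a standard involution and anisotropic norm form `n`
(`IsAnisotropicNormForm`); the quaternion algebra enters only at the end, where a real embedding makes
its norm form positive definite. Lattices and ideals are multiplied as `ℤ_K`-submodules of `Q`.

The main input is the even Clifford order (`exists_order_conjModule_mul_le`): if `n(L) ⊆ 𝔞`, then
`𝔞⁻¹ (star L) L` is contained in an order. Let `O` be the right order of `J`.

* If `J` is normal and `n(J) = 𝔞`, let `L ⊇ J` be a lattice with `n(L) ⊆ 𝔞`. Then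
  `O = 𝔞⁻¹ n(J) O ⊆ 𝔞⁻¹ (star J) J ⊆ 𝔞⁻¹ (star L) L`, and the last module lies in an order, which is
  `O` by maximality. Hence `𝔞 L ⊆ J (star J) L ⊆ 𝔞 J`, and `L = J`
  (`isMaximalLattice_of_isNormalLattice`).
* If `J` is `𝔞`-maximal, choose a maximal order `O'` containing `𝔞⁻¹ (star J) J`. Then
  `n(J O') ⊆ 𝔞` (`latticeNorm_mul_le`), so `J O' = J` and `O' = O`
  (`isNormalLattice_of_isMaximalLattice`).
* If `J` is `𝔞`-maximal and `n(J) ≠ 𝔞`, then `n(J) ⊆ 𝔭 𝔞` for some prime `𝔭`. The finite ring `O / 𝔭 O`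
  has zero divisors, since a finite field in which every element is quadratic over the residue field
  `ℤ_K / 𝔭` is too small. This gives a left ideal `P ⊋ 𝔭 O` of `O` with `n(P) ⊆ 𝔭`
  (`exists_leftIdeal`), and `J 𝔭⁻¹ P` is a larger lattice with norm in `𝔞`
  (`latticeNorm_eq_of_isMaximalLattice`).
-/

/-! ### Alternating products and finite generation -/

section AlternatingProducts

/-- The alternating product `M * N * M * ⋯` with `k` factors. -/
def altProd {S : Type*} [Monoid S] : ℕ → S → S → S
  | 0, _, _ => 1
  | k + 1, M, N => M * altProd k N M

theorem altProd_two_mul {S : Type*} [Monoid S] (M N : S) (k : ℕ) :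
    altProd (2 * k) M N = (M * N) ^ k := by
  induction k with
  | zero => simp [altProd]
  | succ k ih =>
    rw [show 2 * (k + 1) = 2 * k + 1 + 1 by ring, altProd, altProd, ih, pow_succ', mul_assoc]

variable {R A : Type*} [CommRing R] [Ring A] [Algebra R A]

theorem altProd_mono {M N M' N' : Submodule R A} (hM : M ≤ M') (hN : N ≤ N') (k : ℕ) :
    altProd k M N ≤ altProd k M' N' := by
  induction k generalizing M N M' N' with
  | zero => exact le_rfl
  | succ k ih => exact mul_le_mul' hM (ih hN hM)

/-- One step of the Poincaré–Birkhoff–Witt reduction: if the generators in `X`, `Y` anticommute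
with those in `M`, `N` modulo `C` and square into `C`, then a long alternating product involves
`X` or `Y` at most once, in front, up to shorter products with a coefficient in `C`. -/
theorem altProd_sup_le {C : Submodule R A} (hC : ∀ P : Submodule R A, C * P = P * C)
    {M N X Y : Submodule R A} (hXY : X * Y ≤ C) (hYX : Y * X ≤ C)
    (hMY : M * Y ≤ X * N ⊔ C) (hNX : N * X ≤ Y * M ⊔ C) (k : ℕ) :
    altProd (k + 2) (M ⊔ X) (N ⊔ Y) ≤ altProd (k + 2) M N ⊔ X * altProd (k + 1) N M ⊔
      C * altProd k (M ⊔ X) (N ⊔ Y) := by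
  induction k generalizing M N X Y with
  | zero =>
    simp only [altProd, mul_one, Submodule.sup_mul, Submodule.mul_sup]
    refine sup_le (sup_le ?_ ?_) (sup_le ?_ ?_)
    · exact le_sup_of_le_left le_sup_left
    · exact le_sup_of_le_left le_sup_right
    · exact hMY.trans (sup_le (le_sup_of_le_left le_sup_right) le_sup_right)
    · exact le_sup_of_le_right hXY
  | succ k ih =>
    have h1 : altProd (k + 1) M N ≤ altProd (k + 1) (M ⊔ X) (N ⊔ Y) :=
      altProd_mono le_sup_left le_sup_left _
    have key := ih hYX hXY hNX hMY
    rw [altProd]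
    refine (mul_le_mul' le_rfl key).trans ?_
    rw [Submodule.mul_sup, Submodule.mul_sup]
    refine sup_le (sup_le ?_ ?_) ?_
    · rw [Submodule.sup_mul]
      exact sup_le (le_sup_of_le_left le_sup_left) (le_sup_of_le_left le_sup_right)
    · rw [← mul_assoc, Submodule.sup_mul, Submodule.sup_mul]
      refine sup_le ((mul_le_mul' hMY le_rfl).trans ?_) ((mul_le_mul' hXY le_rfl).trans ?_)
      · rw [Submodule.sup_mul, mul_assoc]
        exact sup_le (le_sup_of_le_left le_sup_right) (le_sup_of_le_right (mul_le_mul' le_rfl h1))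
      · exact le_sup_of_le_right (mul_le_mul' le_rfl h1)
    · rw [← mul_assoc, ← hC, mul_assoc]
      exact le_sup_right

/-- If `x * star y + y * star x`, `star x * y + star y * x` and the values `x * star x`,
`star x * x` lie in a central `C` for `x, y` in a finite set `s`, then long enough alternating
products of the spans of `s` and `star s` can be shortened by two factors at the cost of a
coefficient in `C`. -/
theorem exists_altProd_le [StarRing A] {C : Submodule R A}
    (hC : ∀ P : Submodule R A, C * P = P * C) {s : Set A} (hs : s.Finite)
    (h₁ : ∀ x ∈ s, ∀ y ∈ s, x * star y + y * star x ∈ C)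
    (h₂ : ∀ x ∈ s, ∀ y ∈ s, star x * y + star y * x ∈ C)
    (h₃ : ∀ x ∈ s, x * star x ∈ C) (h₄ : ∀ x ∈ s, star x * x ∈ C) :
    ∃ m, ∀ k ≥ m,
      altProd (k + 2) (Submodule.span R s) (Submodule.span R (star '' s)) ≤
        C * altProd k (Submodule.span R s) (Submodule.span R (star '' s)) ∧
      altProd (k + 2) (Submodule.span R (star '' s)) (Submodule.span R s) ≤
        C * altProd k (Submodule.span R (star '' s)) (Submodule.span R s) := by
  induction s, hs using Set.Finite.induction_on with
  | empty =>
    refine ⟨0, fun k _ => ?_⟩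
    simp [altProd]
  | @insert x s _ _ ih =>
    obtain ⟨m, hm⟩ := ih (fun x hx y hy => h₁ x (.inr hx) y (.inr hy))
      (fun x hx y hy => h₂ x (.inr hx) y (.inr hy)) (fun x hx => h₃ x (.inr hx))
      (fun x hx => h₄ x (.inr hx))
    rw [Set.image_insert_eq, Submodule.span_insert, Submodule.span_insert,
      sup_comm (R ∙ x), sup_comm (R ∙ star x)]
    set M := Submodule.span R s
    set N := Submodule.span R (star '' s)
    have hXY : (R ∙ x) * (R ∙ star x) ≤ C := by
      simpa [Submodule.span_mul_span, Submodule.span_le] using h₃ x (.inl rfl)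
    have hYX : (R ∙ star x) * (R ∙ x) ≤ C := by
      simpa [Submodule.span_mul_span, Submodule.span_le] using h₄ x (.inl rfl)
    have hMY : M * (R ∙ star x) ≤ (R ∙ x) * N ⊔ C := by
      rw [Submodule.span_mul_span, Submodule.span_le]
      rintro _ ⟨z, hz, w, hw, rfl⟩
      simp only [Set.mem_singleton_iff.mp hw, SetLike.mem_coe]
      have : z * star x = -(x * star z) + (x * star z + z * star x) := by abel
      rw [this]
      exact Submodule.add_mem_sup (neg_mem (Submodule.mul_mem_mul
        (Submodule.mem_span_singleton_self x) (Submodule.subset_span ⟨z, hz, rfl⟩)))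
        (h₁ x (.inl rfl) z (.inr hz))
    have hNX : N * (R ∙ x) ≤ (R ∙ star x) * M ⊔ C := by
      rw [Submodule.span_mul_span, Submodule.span_le]
      rintro _ ⟨_, ⟨z, hz, rfl⟩, w, hw, rfl⟩
      simp only [Set.mem_singleton_iff.mp hw, SetLike.mem_coe]
      have : star z * x = -(star x * z) + (star x * z + star z * x) := by abel
      rw [this]
      exact Submodule.add_mem_sup (neg_mem (Submodule.mul_mem_mul
        (Submodule.mem_span_singleton_self _) (Submodule.subset_span hz)))
        (h₂ x (.inl rfl) z (.inr hz))
    refine ⟨m + 1, fun k hk => ?_⟩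
    obtain ⟨k, rfl⟩ : ∃ j, k = j + 1 := ⟨k - 1, by omega⟩
    obtain ⟨a₁, a₂⟩ := hm k (by omega)
    obtain ⟨b₁, b₂⟩ := hm (k + 1) (by omega)
    constructor
    · refine (altProd_sup_le hC hXY hYX hMY hNX (k + 1)).trans (sup_le (sup_le ?_ ?_) le_rfl)
      · exact b₁.trans (mul_le_mul' le_rfl (altProd_mono le_sup_left le_sup_left _))
      · refine (mul_le_mul' le_rfl a₂).trans ?_
        rw [← mul_assoc, ← hC, mul_assoc]
        exact mul_le_mul' le_rfl (mul_le_mul' le_sup_right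
          (altProd_mono le_sup_left le_sup_left _))
    · refine (altProd_sup_le hC hYX hXY hNX hMY (k + 1)).trans (sup_le (sup_le ?_ ?_) le_rfl)
      · exact b₂.trans (mul_le_mul' le_rfl (altProd_mono le_sup_left le_sup_left _))
      · refine (mul_le_mul' le_rfl a₁).trans ?_
        rw [← mul_assoc, ← hC, mul_assoc]
        exact mul_le_mul' le_rfl (mul_le_mul' le_sup_right
          (altProd_mono le_sup_left le_sup_left _))

/-- A finitely generated submodule `D` with `D ^ (k + 1) ≤ D ^ k` is contained in a subalgebra that
is finitely generated as a module, namely `(1 + D) ^ k`. -/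
theorem exists_subalgebra_fg_of_pow_succ_le {D : Submodule R A} (hD : D.FG) {k : ℕ}
    (h : D ^ (k + 1) ≤ D ^ k) :
    ∃ Λ : Subalgebra R A, (Subalgebra.toSubmodule Λ).FG ∧ D ≤ Subalgebra.toSubmodule Λ := by
  set T : Submodule R A := 1 ⊔ D
  have hT1 : (1 : Submodule R A) ≤ T := le_sup_left
  have hTD : D ≤ T := le_sup_right
  have hle : ∀ n, T ^ n ≤ T ^ (n + 1) := fun n => by
    rw [pow_succ]; exact (mul_one (T ^ n)).ge.trans (mul_le_mul' le_rfl hT1)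
  have hexp : ∀ n, T ^ (n + 1) ≤ T ^ n ⊔ D ^ (n + 1) := fun n => by
    induction n with
    | zero => simp [T]
    | succ n ih =>
      rw [pow_succ']
      refine (mul_le_mul' le_rfl ih).trans ?_
      rw [Submodule.mul_sup, ← pow_succ', Submodule.sup_mul, one_mul, ← pow_succ']
      exact sup_le le_sup_left (sup_le (le_sup_of_le_left (pow_le_pow_left' hTD _)) le_sup_right)
  have hst : T ^ (k + 1) = T ^ k :=
    le_antisymm ((hexp k).trans (sup_le le_rfl (h.trans (pow_le_pow_left' hTD k)))) (hle k)
  have hadd : ∀ n, T ^ (k + n) = T ^ k := fun n => by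
    induction n with
    | zero => rfl
    | succ n ih => rw [← add_assoc, pow_succ, ih, ← pow_succ, hst]
  have h1 : (1 : A) ∈ T ^ k := Submodule.one_le.mp (one_le_pow_of_one_le' hT1 k)
  refine ⟨(T ^ k).toSubalgebra h1 fun x y hx hy => ?_, ?_, ?_⟩
  · rw [← hadd k, pow_add]
    exact Submodule.mul_mem_mul hx hy
  · rw [Submodule.toSubalgebra_toSubmodule]
    exact Submodule.FG.pow (Submodule.FG.sup (by
      rw [Submodule.one_eq_span]; exact Submodule.fg_span_singleton _) hD) _
  · rw [Submodule.toSubalgebra_toSubmodule, ← hst, pow_succ']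
    refine (mul_one D).ge.trans (mul_le_mul' hTD (one_le_pow_of_one_le' hT1 k))

end AlternatingProducts

/-! ### Standard involutions, norm and trace -/

section NormForm

variable {K : Type*} [Field K] {Q : Type*} [Ring Q] [Algebra K Q]

/-- The reduced trace of an algebra with a standard involution with norm form `n`, as the polar
form of `n` paired with `1`; see `IsAnisotropicNormForm.add_star`. -/
def normFormTrace (n : QuadraticForm K Q) : Q →ₗ[K] K :=
  n.polarBilin 1

variable [StarRing Q]

/-- The involution `star` of the `K`-algebra `Q` is standard with anisotropic norm form `n`: it is
`K`-linear and `x * star x = n x`, which vanishes only for `x = 0`. -/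
structure IsAnisotropicNormForm (n : QuadraticForm K Q) : Prop where
  star_algebraMap : ∀ r : K, star (algebraMap K Q r) = algebraMap K Q r
  mul_star : ∀ x : Q, x * star x = algebraMap K Q (n x)
  anisotropic : n.Anisotropic

namespace IsAnisotropicNormForm

variable {n : QuadraticForm K Q} (h : IsAnisotropicNormForm n)
include h

theorem star_smul (r : K) (x : Q) : star (r • x) = r • star x := by
  rw [Algebra.smul_def, star_mul, h.star_algebraMap, ← Algebra.commutes, ← Algebra.smul_def]

theorem algebraMap_polar (x y : Q) :
    algebraMap K Q (QuadraticMap.polar n x y) = x * star y + y * star x := by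
  rw [QuadraticMap.polar, map_sub, map_sub, ← h.mul_star, ← h.mul_star, ← h.mul_star, star_add]
  noncomm_ring

theorem add_star (x : Q) : algebraMap K Q (normFormTrace n x) = x + star x := by
  change algebraMap K Q (QuadraticMap.polar n 1 x) = _
  rw [h.algebraMap_polar, star_one, one_mul, mul_one, add_comm]

theorem star_mul_self (x : Q) : star x * x = algebraMap K Q (n x) := by
  have hc := Algebra.commutes (normFormTrace n x) x
  rw [h.add_star, add_mul, mul_add] at hc
  rw [← h.mul_star, add_left_cancel hc]

theorem algebraMap_trace_star_mul (x y : Q) :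
    algebraMap K Q (normFormTrace n (star x * y)) = star x * y + star y * x := by
  rw [h.add_star, star_mul, star_star]

theorem mul_self_eq (x : Q) : x * x = normFormTrace n x • x - algebraMap K Q (n x) := by
  rw [Algebra.smul_def, h.add_star, ← h.star_mul_self, add_mul, add_sub_cancel_right]

theorem polarBilin_nondegenerate [CharZero K] : LinearMap.BilinForm.Nondegenerate n.polarBilin := by
  have hself : ∀ x, n.polarBilin x x = 0 → x = 0 := fun x hx => by
    refine h.anisotropic x ?_
    have : (2 : K) * n x = 0 := by
      simpa [QuadraticMap.polar_self] using hx
    simpa using this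
  exact ⟨fun x hx => hself x (hx x), fun x hx => hself x (hx x)⟩

variable [Nontrivial Q]

theorem map_mul (x y : Q) : n (x * y) = n x * n y := by
  apply (algebraMap K Q).injective
  rw [← h.mul_star, star_mul, mul_assoc, ← mul_assoc y, h.mul_star, ← mul_assoc, ← Algebra.commutes,
    mul_assoc, h.mul_star, ← _root_.map_mul, mul_comm]

theorem map_algebraMap (r : K) : n (algebraMap K Q r) = r * r := by
  apply (algebraMap K Q).injective
  rw [← h.mul_star, h.star_algebraMap, _root_.map_mul]

theorem trace_star_mul (x y : Q) :
    normFormTrace n (star x * y) = QuadraticMap.polar n x y := by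
  apply (algebraMap K Q).injective
  rw [h.add_star, star_mul, star_star, QuadraticMap.polar, map_sub, map_sub, ← h.star_mul_self,
    ← h.star_mul_self, ← h.star_mul_self, star_add]
  noncomm_ring

theorem map_add (x y : Q) : n (x + y) = n x + n y + normFormTrace n (star x * y) := by
  rw [h.trace_star_mul, QuadraticMap.polar]
  ring

theorem algebraMap_trace_star_mul' (x y : Q) :
    algebraMap K Q (normFormTrace n (star x * y)) = x * star y + y * star x := by
  rw [h.trace_star_mul, h.algebraMap_polar]

end IsAnisotropicNormForm

end NormForm

/-! ### Products of ideals and lattices, and conjugate lattices -/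

section CentralModule

variable {K : Type*} [Field K] (Q : Type*) [Ring Q] [Algebra K Q] [Algebra (𝓞 K) Q]
  [IsScalarTower (𝓞 K) K Q]

/-- A `ℤ_K`-submodule of `K`, viewed inside the centre of the algebra `Q`. The product `𝔟 L` of an
ideal and a lattice is then a product of submodules of `Q`. -/
def centralModule (𝔟 : Submodule (𝓞 K) K) : Submodule (𝓞 K) Q :=
  𝔟.map ((Algebra.ofId K Q).restrictScalars (𝓞 K)).toLinearMap

theorem centralModule_mul (𝔟 𝔠 : Submodule (𝓞 K) K) :
    centralModule Q (𝔟 * 𝔠) = centralModule Q 𝔟 * centralModule Q 𝔠 :=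
  Submodule.map_mul _ _ _

theorem centralModule_one : centralModule Q (1 : Submodule (𝓞 K) K) = 1 :=
  Submodule.map_one _

variable {Q}

theorem mem_centralModule {𝔟 : Submodule (𝓞 K) K} {x : Q} :
    x ∈ centralModule Q 𝔟 ↔ ∃ b ∈ 𝔟, algebraMap K Q b = x :=
  Iff.rfl

theorem algebraMap_mem_centralModule {𝔟 : Submodule (𝓞 K) K} {b : K} (hb : b ∈ 𝔟) :
    algebraMap K Q b ∈ centralModule Q 𝔟 :=
  ⟨b, hb, rfl⟩

theorem centralModule_mul_comm (𝔟 : Submodule (𝓞 K) K) (P : Submodule (𝓞 K) Q) :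
    centralModule Q 𝔟 * P = P * centralModule Q 𝔟 := by
  refine Submodule.mul_comm_of_commute ?_
  rintro _ ⟨b, -, rfl⟩ n -
  exact Algebra.commutes b n

end CentralModule

namespace IsAnisotropicNormForm

variable {K : Type*} [Field K] {Q : Type*} [Ring Q] [Algebra K Q]
  [Algebra (𝓞 K) Q] [IsScalarTower (𝓞 K) K Q] [StarRing Q] {n : QuadraticForm K Q}
  (h : IsAnisotropicNormForm n)

/-- The conjugate `{star x | x ∈ M}` of a submodule of `Q`. -/
def conjModule (M : Submodule (𝓞 K) Q) : Submodule (𝓞 K) Q :=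
  M.map ({ toFun := star, map_add' := star_add, map_smul' := fun r x => by
            rw [← IsScalarTower.algebraMap_smul K r x, h.star_smul]; simp } : Q →ₗ[𝓞 K] Q)

theorem star_mem_conjModule {M : Submodule (𝓞 K) Q} {x : Q} (hx : x ∈ M) :
    star x ∈ h.conjModule M :=
  ⟨x, hx, rfl⟩

theorem conjModule_span (s : Set Q) :
    h.conjModule (Submodule.span (𝓞 K) s) = Submodule.span (𝓞 K) (star '' s) :=
  Submodule.map_span _ _

theorem conjModule_mono {M N : Submodule (𝓞 K) Q} (hle : M ≤ N) :
    h.conjModule M ≤ h.conjModule N :=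
  Submodule.map_mono hle

theorem conjModule_fg {J : Submodule (𝓞 K) Q} (hJ : J.FG) : (h.conjModule J).FG :=
  hJ.map _

theorem conjModule_mul (M N : Submodule (𝓞 K) Q) :
    h.conjModule (M * N) = h.conjModule N * h.conjModule M := by
  apply le_antisymm
  · refine Submodule.map_le_iff_le_comap.mpr (Submodule.mul_le.mpr fun a ha b hb => ?_)
    change star (a * b) ∈ h.conjModule N * h.conjModule M
    rw [star_mul]
    exact Submodule.mul_mem_mul (h.star_mem_conjModule hb) (h.star_mem_conjModule ha)
  · refine Submodule.mul_le.mpr ?_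
    rintro _ ⟨b, hb, rfl⟩ _ ⟨a, ha, rfl⟩
    exact ⟨a * b, Submodule.mul_mem_mul ha hb, star_mul a b⟩

theorem centralModule_latticeNorm_le (J : Submodule (𝓞 K) Q) :
    centralModule Q (latticeNorm n J) ≤ h.conjModule J * J := by
  refine Submodule.map_le_iff_le_comap.mpr (Submodule.span_le.mpr ?_)
  rintro _ ⟨x, hx, rfl⟩
  change algebraMap K Q (n x) ∈ h.conjModule J * J
  rw [← h.star_mul_self]
  exact Submodule.mul_mem_mul (h.star_mem_conjModule hx) hx

theorem centralModule_latticeNorm_le' (J : Submodule (𝓞 K) Q) :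
    centralModule Q (latticeNorm n J) ≤ J * h.conjModule J := by
  refine Submodule.map_le_iff_le_comap.mpr (Submodule.span_le.mpr ?_)
  rintro _ ⟨x, hx, rfl⟩
  change algebraMap K Q (n x) ∈ J * h.conjModule J
  rw [← h.mul_star]
  exact Submodule.mul_mem_mul hx (h.star_mem_conjModule hx)

end IsAnisotropicNormForm

theorem latticeNorm_le_iff {K : Type*} [Field K] {V : Type*} [AddCommGroup V] [Module K V]
    [Module (𝓞 K) V] [IsScalarTower (𝓞 K) K V] {q : QuadraticForm K V}
    {J : Submodule (𝓞 K) V} {𝔟 : Submodule (𝓞 K) K} :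
    latticeNorm q J ≤ 𝔟 ↔ ∀ x ∈ J, q x ∈ 𝔟 := by
  rw [latticeNorm, Submodule.span_le, Set.image_subset_iff]
  rfl

namespace IsAnisotropicNormForm

variable {K : Type*} [Field K] {Q : Type*} [Ring Q] [Nontrivial Q] [Algebra K Q]
  [Algebra (𝓞 K) Q] [IsScalarTower (𝓞 K) K Q] [StarRing Q] {n : QuadraticForm K Q}
  (h : IsAnisotropicNormForm n)

include h in
theorem trace_star_mul_mem {J : Submodule (𝓞 K) Q} {𝔟 : Submodule (𝓞 K) K}
    (hJ : latticeNorm n J ≤ 𝔟) {x y : Q} (hx : x ∈ J) (hy : y ∈ J) :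
    normFormTrace n (star x * y) ∈ 𝔟 := by
  rw [latticeNorm_le_iff] at hJ
  rw [h.trace_star_mul]
  exact sub_mem (sub_mem (hJ _ (add_mem hx hy)) (hJ _ hx)) (hJ _ hy)

theorem trace_mem_of_mem_conjModule_mul {J : Submodule (𝓞 K) Q} {𝔟 : Submodule (𝓞 K) K}
    (hJ : latticeNorm n J ≤ 𝔟) {v : Q} (hv : v ∈ h.conjModule J * J) :
    normFormTrace n v ∈ 𝔟 := by
  induction hv using Submodule.mul_induction_on' with
  | mem_mul_mem a ha b hb =>
    obtain ⟨x, hx, rfl⟩ := ha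
    exact h.trace_star_mul_mem hJ hx hb
  | add x _ y _ hx hy =>
    rw [_root_.map_add]
    exact add_mem hx hy

/-- The norm of a product `J I` is bounded by `n(J) n(I)` once the products `star x * y` with
`x, y ∈ J` lie in `n(J) O` for some `O` with `O I ⊆ I`: the cross terms
`star (x * y) * (x' * y') = star y * (star x * x') * y'` then lie in `n(J) (star I) I`. -/
theorem latticeNorm_mul_le {J I O : Submodule (𝓞 K) Q} {𝔟 𝔠 : Submodule (𝓞 K) K}
    (hJ : latticeNorm n J ≤ 𝔟) (hJO : h.conjModule J * J ≤ centralModule Q 𝔟 * O)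
    (hOI : O * I ≤ I) (hI : latticeNorm n I ≤ 𝔠) :
    latticeNorm n (J * I) ≤ 𝔟 * 𝔠 := by
  have hle : h.conjModule (J * I) * (J * I) ≤ centralModule Q 𝔟 * (h.conjModule I * I) := by
    calc h.conjModule (J * I) * (J * I) = h.conjModule I * (h.conjModule J * J) * I := by
          simp only [conjModule_mul, mul_assoc]
      _ ≤ h.conjModule I * (centralModule Q 𝔟 * O) * I :=
          mul_le_mul' (mul_le_mul' le_rfl hJO) le_rfl
      _ = centralModule Q 𝔟 * (h.conjModule I * (O * I)) := by
          rw [← mul_assoc (h.conjModule I), ← centralModule_mul_comm]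
          simp only [mul_assoc]
      _ ≤ _ := mul_le_mul' le_rfl (mul_le_mul' le_rfl hOI)
  have htr : ∀ v ∈ centralModule Q 𝔟 * (h.conjModule I * I),
      normFormTrace n v ∈ 𝔟 * 𝔠 := fun v hv => by
    induction hv using Submodule.mul_induction_on' with
    | mem_mul_mem a ha v hv =>
      obtain ⟨b, hb, rfl⟩ := mem_centralModule.mp ha
      rw [← Algebra.smul_def, map_smul]
      exact Submodule.mul_mem_mul hb (h.trace_mem_of_mem_conjModule_mul hI hv)
    | add x _ y _ hx hy =>
      rw [_root_.map_add]
      exact add_mem hx hy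
  rw [latticeNorm_le_iff] at hJ hI ⊢
  intro z hz
  induction hz using Submodule.mul_induction_on' with
  | mem_mul_mem a ha b hb =>
    rw [h.map_mul]
    exact Submodule.mul_mem_mul (hJ _ ha) (hI _ hb)
  | add x hx y hy ihx ihy =>
    rw [h.map_add]
    exact add_mem (add_mem ihx ihy)
      (htr _ (hle (Submodule.mul_mem_mul (h.star_mem_conjModule hx) hy)))

end IsAnisotropicNormForm

/-! ### Orders -/

section RightOrder

variable {K : Type*} [Field K] {Q : Type*} [Ring Q] [Algebra (𝓞 K) Q]

theorem mul_rightOrder_le (J : Submodule (𝓞 K) Q) :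
    J * Subalgebra.toSubmodule (rightOrder J) ≤ J :=
  Submodule.mul_le.mpr fun x hx _ hα => hα x hx

theorem le_rightOrder_of_mul_le {J I : Submodule (𝓞 K) Q} (hle : J * I ≤ J) :
    I ≤ Subalgebra.toSubmodule (rightOrder J) :=
  fun _ hα _ hx => hle (Submodule.mul_mem_mul hx hα)

theorem Subalgebra.one_le_toSubmodule {R A : Type*} [CommRing R] [Ring A] [Algebra R A]
    (O : Subalgebra R A) : 1 ≤ Subalgebra.toSubmodule O :=
  Submodule.one_le.mpr O.one_mem

theorem Subalgebra.le_mul_toSubmodule {R A : Type*} [CommRing R] [Ring A] [Algebra R A]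
    (J : Submodule R A) (O : Subalgebra R A) : J ≤ J * Subalgebra.toSubmodule O :=
  (mul_one J).ge.trans (mul_le_mul' le_rfl O.one_le_toSubmodule)

end RightOrder

section Lattices

variable {K : Type*} [Field K]

theorem smul_right_injective_ringOfIntegers {V : Type*} [AddCommGroup V] [Module K V]
    [Module (𝓞 K) V] [IsScalarTower (𝓞 K) K V] {r : 𝓞 K} (hr : r ≠ 0) :
    Function.Injective (fun v : V => r • v) := by
  intro v w hvw
  simp only [← IsScalarTower.algebraMap_smul K r] at hvw
  exact smul_right_injective V (by simpa using hr : algebraMap (𝓞 K) K r ≠ 0) hvw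

theorem Submodule.IsLattice.exists_smul_mem [NumberField K] {V : Type*}
    [AddCommGroup V] [Module K V]
    [Module (𝓞 K) V] [IsScalarTower (𝓞 K) K V] {L : Submodule (𝓞 K) V} (hL : L.IsLattice K)
    (v : V) : ∃ r : 𝓞 K, r ≠ 0 ∧ r • v ∈ L := by
  have hv : v ∈ Submodule.span K (L : Set V) := hL.span_eq_top ▸ Submodule.mem_top
  induction hv using Submodule.span_induction with
  | mem x hx => exact ⟨1, one_ne_zero, by simpa using hx⟩
  | zero => exact ⟨1, one_ne_zero, by simp⟩
  | add x y _ _ hx hy =>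
    obtain ⟨r, hr, hrx⟩ := hx
    obtain ⟨s, hs, hsy⟩ := hy
    refine ⟨r * s, mul_ne_zero hr hs, ?_⟩
    rw [smul_add]
    refine add_mem ?_ ?_
    · rw [mul_comm, mul_smul]; exact L.smul_mem s hrx
    · rw [mul_smul]; exact L.smul_mem r hsy
  | smul c x _ hx =>
    obtain ⟨r, hr, hrx⟩ := hx
    obtain ⟨a, d, hd, rfl⟩ := IsFractionRing.div_surjective (A := 𝓞 K) c
    have hd0 : d ≠ 0 := nonZeroDivisors.ne_zero hd
    refine ⟨d * r, mul_ne_zero hd0 hr, ?_⟩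
    have : (d * r) • ((algebraMap (𝓞 K) K a / algebraMap (𝓞 K) K d) • x) = a • (r • x) := by
      have : algebraMap (𝓞 K) K d ≠ 0 := by simpa using hd0
      simp only [← IsScalarTower.algebraMap_smul K (_ : 𝓞 K) (_ : V), smul_smul, map_mul]
      congr 1
      field_simp
    rw [this]
    exact L.smul_mem a hrx

variable [NumberField K] {Q : Type*} [Ring Q] [Algebra K Q] [Algebra (𝓞 K) Q]
  [IsScalarTower (𝓞 K) K Q]

/-- For nonzero `r ∈ J ∩ ℤ_K`, the right order is contained in `r⁻¹ J`. -/
theorem rightOrder_fg {J : Submodule (𝓞 K) Q} (hJ : J.IsLattice K) :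
    (Subalgebra.toSubmodule (rightOrder J)).FG := by
  obtain ⟨r, hr, hrJ⟩ := hJ.exists_smul_mem (1 : Q)
  refine Submodule.fg_of_fg_map_injective (LinearMap.lsmul (𝓞 K) Q r)
    (smul_right_injective_ringOfIntegers (K := K) hr) (hJ.fg.of_le ?_)
  rintro _ ⟨x, hx, rfl⟩
  have := hx _ hrJ
  rwa [smul_mul_assoc, one_mul] at this

theorem centralModule_coe_mul_inv {𝔞 : FractionalIdeal (𝓞 K)⁰ K} (h𝔞 : 𝔞 ≠ 0) :
    centralModule Q (𝔞 : Submodule (𝓞 K) K) *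
      centralModule Q ((𝔞⁻¹ : FractionalIdeal (𝓞 K)⁰ K) : Submodule (𝓞 K) K) = 1 := by
  rw [← centralModule_mul, ← FractionalIdeal.coe_mul, mul_inv_cancel₀ h𝔞,
    FractionalIdeal.coe_one, centralModule_one]

theorem centralModule_coe_fg (𝔞 : FractionalIdeal (𝓞 K)⁰ K) :
    (centralModule Q (𝔞 : Submodule (𝓞 K) K)).FG :=
  ((Submodule.fg_top _).mp ((FractionalIdeal.isNoetherian 𝔞).noetherian ⊤)).map _

end Lattices

namespace IsAnisotropicNormForm

variable {K : Type*} [Field K] [NumberField K] {Q : Type*} [Ring Q] [Nontrivial Q] [Algebra K Q]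
  [Algebra (𝓞 K) Q] [IsScalarTower (𝓞 K) K Q] [StarRing Q] {n : QuadraticForm K Q}
  (h : IsAnisotropicNormForm n)

include h

theorem latticeNorm_fg {J : Submodule (𝓞 K) Q} (hJ : J.FG) : (latticeNorm n J).FG :=
  Submodule.fg_of_fg_map_injective _ (algebraMap K Q).injective
    (((h.conjModule_fg hJ).mul hJ).of_le (h.centralModule_latticeNorm_le J))

theorem latticeNorm_ne_bot {J : Submodule (𝓞 K) Q} (hJ : J.IsLattice K) : latticeNorm n J ≠ ⊥ := by
  obtain ⟨r, hr, hrJ⟩ := hJ.exists_smul_mem (1 : Q)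
  intro h0
  have h1 : n (r • 1) = 0 := latticeNorm_le_iff.mp h0.le _ hrJ
  have h2 := h.anisotropic _ h1
  rw [← smul_zero r] at h2
  exact one_ne_zero (smul_right_injective_ringOfIntegers (K := K) hr h2)

theorem coe_ne_zero_of_latticeNorm_le {J : Submodule (𝓞 K) Q} (hJ : J.IsLattice K)
    {𝔞 : FractionalIdeal (𝓞 K)⁰ K} (hle : latticeNorm n J ≤ 𝔞) : 𝔞 ≠ 0 := by
  rintro rfl
  exact h.latticeNorm_ne_bot hJ (le_bot_iff.mp (by simpa using hle))

/-- The norms of the elements of an order are integral: multiplication by such a norm stabilizes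
the finitely generated module `n(O)`, as `n` is multiplicative. -/
theorem latticeNorm_order_le_one {O : Subalgebra (𝓞 K) Q} (hO : IsOrder O) :
    latticeNorm n (Subalgebra.toSubmodule O) ≤ 1 := by
  refine latticeNorm_le_iff.mpr fun x hx => Submodule.mem_one.mpr ?_
  refine IsIntegrallyClosed.isIntegral_iff.mp (isIntegral_of_smul_mem_submodule
    (latticeNorm n (Subalgebra.toSubmodule O)) (h.latticeNorm_ne_bot hO)
    (h.latticeNorm_fg hO.fg) _ fun c hc => ?_)
  induction hc using Submodule.span_induction with
  | mem c hc =>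
    obtain ⟨y, hy, rfl⟩ := hc
    rw [smul_eq_mul, ← h.map_mul]
    exact Submodule.subset_span ⟨x * y, O.mul_mem hx hy, rfl⟩
  | zero => simp
  | add a b _ _ ha hb => rw [smul_add]; exact add_mem ha hb
  | smul r a _ ha => rw [smul_comm]; exact Submodule.smul_mem _ r ha

theorem trace_mem_one_of_mem_order {O : Subalgebra (𝓞 K) Q} (hO : IsOrder O) {x : Q}
    (hx : x ∈ O) : normFormTrace n x ∈ (1 : Submodule (𝓞 K) K) := by
  have := h.trace_star_mul_mem (h.latticeNorm_order_le_one hO) O.one_mem hx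
  rwa [star_one, one_mul] at this

theorem star_mem_of_mem_order {O : Subalgebra (𝓞 K) Q} (hO : IsOrder O) {x : Q} (hx : x ∈ O) :
    star x ∈ O := by
  obtain ⟨t, ht⟩ := Submodule.mem_one.mp (h.trace_mem_one_of_mem_order hO hx)
  have : star x = algebraMap (𝓞 K) Q t - x := by
    rw [IsScalarTower.algebraMap_apply (𝓞 K) K Q, ht, h.add_star, add_sub_cancel_left]
  rw [this]
  exact sub_mem (O.algebraMap_mem t) hx

/-- The even Clifford order: if `n(L) ⊆ 𝔞`, then `𝔞⁻¹ (star L) L` is contained in an order.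
Generators of `L` satisfy the Clifford relations `x * star y + y * star x ∈ 𝔞`, so alternating
products with more factors than there are generators reduce to shorter ones with coefficients in
`𝔞`, and the ring generated by `𝔞⁻¹ (star L) L` is finitely generated as a module. -/
theorem exists_order_conjModule_mul_le {L : Submodule (𝓞 K) Q} (hL : L.IsLattice K)
    {𝔞 : FractionalIdeal (𝓞 K)⁰ K} (hle : latticeNorm n L ≤ 𝔞) :
    ∃ Λ : Subalgebra (𝓞 K) Q, IsOrder Λ ∧
      h.conjModule L * L ≤ centralModule Q (𝔞 : Submodule (𝓞 K) K) * Subalgebra.toSubmodule Λ := by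
  have h𝔞 := h.coe_ne_zero_of_latticeNorm_le hL hle
  set C := centralModule Q (𝔞 : Submodule (𝓞 K) K) with hCdef
  set C' := centralModule Q ((𝔞⁻¹ : FractionalIdeal (𝓞 K)⁰ K) : Submodule (𝓞 K) K) with hC'def
  have hCC' : C * C' = 1 := centralModule_coe_mul_inv h𝔞
  have hC'C : C' * C = 1 := by rw [centralModule_mul_comm, hCC']
  set N := h.conjModule L with hN
  obtain ⟨m, hm⟩ : ∃ m, (N * L) ^ (m + 1) ≤ C * (N * L) ^ m := by
    obtain ⟨s, hs⟩ := hL.fg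
    have hsL : ∀ x ∈ (s : Set Q), x ∈ L := fun x hx => hs ▸ Submodule.subset_span hx
    obtain ⟨m, hm⟩ := exists_altProd_le (R := 𝓞 K) (C := C) (centralModule_mul_comm _)
      s.finite_toSet
      (fun x hx y hy => by
        rw [← h.algebraMap_trace_star_mul']
        exact algebraMap_mem_centralModule (h.trace_star_mul_mem hle (hsL x hx) (hsL y hy)))
      (fun x hx y hy => by
        rw [← h.algebraMap_trace_star_mul]
        exact algebraMap_mem_centralModule (h.trace_star_mul_mem hle (hsL x hx) (hsL y hy)))
      (fun x hx => by
        rw [h.mul_star]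
        exact algebraMap_mem_centralModule (latticeNorm_le_iff.mp hle x (hsL x hx)))
      (fun x hx => by
        rw [h.star_mul_self]
        exact algebraMap_mem_centralModule (latticeNorm_le_iff.mp hle x (hsL x hx)))
    refine ⟨m, ?_⟩
    have := (hm (2 * m) (by omega)).2
    rwa [← h.conjModule_span, hs, ← hN, show 2 * m + 2 = 2 * (m + 1) by ring, altProd_two_mul,
      altProd_two_mul] at this
  have hcomm : ∀ k, (C' * (N * L)) ^ k = C' ^ k * (N * L) ^ k := fun k =>
    Commute.mul_pow (centralModule_mul_comm _ _) k
  obtain ⟨Λ, hΛ, hDΛ⟩ := exists_subalgebra_fg_of_pow_succ_le (D := C' * (N * L)) (k := m)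
    ((centralModule_coe_fg _).mul ((h.conjModule_fg hL.fg).mul hL.fg)) (by
      rw [hcomm, hcomm]
      refine (mul_le_mul' le_rfl hm).trans ?_
      rw [← mul_assoc, pow_succ, mul_assoc _ C', hC'C, mul_one])
  refine ⟨Λ, ⟨hΛ, ?_⟩, ?_⟩
  -- `Λ` spans `Q`, since `c * star (r • 1) * (t • q) ∈ Λ` for suitable nonzero `c ∈ 𝔞⁻¹`, `r`, `t`.
  · rw [eq_top_iff]
    rintro q -
    obtain ⟨r, hr, hrL⟩ := hL.exists_smul_mem (1 : Q)
    obtain ⟨t, ht, htL⟩ := hL.exists_smul_mem q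
    obtain ⟨c, hc, hc0⟩ := Submodule.exists_mem_ne_zero_of_ne_bot
      (p := ((𝔞⁻¹ : FractionalIdeal (𝓞 K)⁰ K) : Submodule (𝓞 K) K))
      (FractionalIdeal.coeToSubmodule_ne_bot.mpr (inv_ne_zero h𝔞))
    have hmem := hDΛ (Submodule.mul_mem_mul (algebraMap_mem_centralModule hc)
      (Submodule.mul_mem_mul (h.star_mem_conjModule hrL) htL))
    have heq : algebraMap K Q c * (star (r • (1 : Q)) * t • q) =
        (c * algebraMap (𝓞 K) K r * algebraMap (𝓞 K) K t) • q := by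
      rw [← IsScalarTower.algebraMap_smul K r, ← IsScalarTower.algebraMap_smul K t, h.star_smul,
        star_one, smul_mul_assoc, one_mul, ← Algebra.smul_def, smul_smul, smul_smul, mul_assoc]
    rw [heq] at hmem
    have hne : c * algebraMap (𝓞 K) K r * algebraMap (𝓞 K) K t ≠ 0 := by
      simp [hc0, hr, ht]
    exact (Submodule.smul_mem_iff _ hne).mp (Submodule.subset_span hmem)
  · calc N * L = C * (C' * (N * L)) := by rw [← mul_assoc, hCC', one_mul]
      _ ≤ _ := mul_le_mul' le_rfl hDΛ

/-- Every order lies in a maximal one: the orders containing `Λ` are contained in the dual of `Λ`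
for the trace form, which is finitely generated. -/
theorem exists_isMaximalOrder_ge [FiniteDimensional K Q] {Λ : Subalgebra (𝓞 K) Q}
    (hΛ : IsOrder Λ) : ∃ O : Subalgebra (𝓞 K) Q, IsMaximalOrder O ∧ Λ ≤ O := by
  classical
  obtain ⟨F, hF, hle⟩ : ∃ F : Submodule (𝓞 K) Q, F.FG ∧ ∀ O : Subalgebra (𝓞 K) Q, IsOrder O →
      Λ ≤ O → Subalgebra.toSubmodule O ≤ F := by
    -- A multiple `b` of some `K`-basis of `Q` lies in `Λ`; the dual of its span contains every `O`.
    let b₀ := Module.finBasis K Q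
    choose r hr hrΛ using fun i => hΛ.exists_smul_mem (b₀ i)
    let b := b₀.isUnitSMul (w := fun i => algebraMap (𝓞 K) K (r i))
      fun i => IsUnit.mk0 _ (by simpa using hr i)
    refine ⟨LinearMap.BilinForm.dualSubmodule n.polarBilin (Submodule.span (𝓞 K) (Set.range b)),
      ?_, fun O hO hΛO x hx y hy => ?_⟩
    · rw [LinearMap.BilinForm.dualSubmodule_span_of_basis _ h.polarBilin_nondegenerate b]
      exact Submodule.fg_span (Set.finite_range _)
    · have hyO : y ∈ O := by
        refine hΛO (Submodule.span_le.mpr ?_ hy : y ∈ Subalgebra.toSubmodule Λ)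
        rintro _ ⟨i, rfl⟩
        simpa [b, Module.Basis.isUnitSMul_apply] using hrΛ i
      change QuadraticMap.polar n x y ∈ (1 : Submodule (𝓞 K) K)
      rw [← h.trace_star_mul]
      exact h.trace_star_mul_mem (h.latticeNorm_order_le_one hO) hx hyO
  have : IsNoetherian (𝓞 K) F := isNoetherian_of_fg_of_noetherian F hF
  obtain ⟨_, ⟨O, ⟨hO, hΛO⟩, rfl⟩, hmax⟩ := set_has_maximal_iff_noetherian.mpr this
    ((fun O => (Subalgebra.toSubmodule O).comap F.subtype) '' {O | IsOrder O ∧ Λ ≤ O})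
    ⟨_, Λ, ⟨hΛ, le_rfl⟩, rfl⟩
  refine ⟨O, ⟨hO, fun O' hO' hOO' => ?_⟩, hΛO⟩
  have hle' := hle O' hO' (hΛO.trans hOO')
  have hn := hmax _ ⟨O', ⟨hO', hΛO.trans hOO'⟩, rfl⟩
  by_contra hne
  refine hn (lt_of_le_not_ge (fun x hx => hOO' hx) fun hge => hne ?_)
  exact le_antisymm (fun x hx => hge (show (⟨x, hle' hx⟩ : F) ∈ _ from hx)) hOO'

/-- If `J` is normal with right order `O` and `n(J) = 𝔟`, then `(star L) L ⊆ 𝔟 O` for all lattices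
`L ⊇ J` with `n(L) ⊆ 𝔟`. Indeed `O = 𝔟⁻¹ n(J) O ⊆ 𝔟⁻¹ (star J) J ⊆ 𝔟⁻¹ (star L) L`, and the last
module is contained in an order, which is `O` by maximality. -/
theorem conjModule_mul_le_of_isNormalLattice {J L : Submodule (𝓞 K) Q} (hJ : IsNormalLattice J)
    (hL : L.IsLattice K) (hJL : J ≤ L) {𝔟 : FractionalIdeal (𝓞 K)⁰ K}
    (hJ𝔟 : latticeNorm n J = 𝔟) (hL𝔟 : latticeNorm n L ≤ 𝔟) :
    h.conjModule L * L ≤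
      centralModule Q (𝔟 : Submodule (𝓞 K) K) * Subalgebra.toSubmodule (rightOrder J) := by
  have h𝔟 := h.coe_ne_zero_of_latticeNorm_le hL hL𝔟
  obtain ⟨Λ, hΛ, hLΛ⟩ := h.exists_order_conjModule_mul_le hL hL𝔟
  set C := centralModule Q (𝔟 : Submodule (𝓞 K) K) with hC
  set C' := centralModule Q ((𝔟⁻¹ : FractionalIdeal (𝓞 K)⁰ K) : Submodule (𝓞 K) K) with hC'
  have hC'C : C' * C = 1 := by rw [centralModule_mul_comm, centralModule_coe_mul_inv h𝔟]
  have hOΛ : rightOrder J ≤ Λ := by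
    rw [← Subalgebra.toSubmodule.le_iff_le]
    set O := Subalgebra.toSubmodule (rightOrder J)
    calc O = C' * (C * O) := by rw [← mul_assoc, hC'C, one_mul]
      _ ≤ C' * (h.conjModule J * J * O) := by
          refine mul_le_mul' le_rfl (mul_le_mul' ?_ le_rfl)
          rw [hC, ← hJ𝔟]
          exact h.centralModule_latticeNorm_le J
      _ ≤ C' * (h.conjModule L * L) := by
          rw [mul_assoc]
          exact mul_le_mul' le_rfl (mul_le_mul' (h.conjModule_mono hJL)
            ((mul_rightOrder_le J).trans hJL))
      _ ≤ C' * (C * Subalgebra.toSubmodule Λ) := mul_le_mul' le_rfl hLΛ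
      _ = Subalgebra.toSubmodule Λ := by rw [← mul_assoc, hC'C, one_mul]
  rwa [hJ.2.2 Λ hΛ hOΛ] at hLΛ

end IsAnisotropicNormForm

/-! ### Left ideals of an order above a prime -/

/-- Wedderburn's little theorem and cyclicity of the unit group: a finite ring without zero divisors
consists of `0` and the powers of one element. -/
theorem exists_forall_eq_zero_or_eq_pow (A : Type*) [Ring A] [NoZeroDivisors A] [Finite A] :
    ∃ g : A, ∀ x : A, x = 0 ∨ ∃ k : ℕ, x = g ^ k := by
  rcases subsingleton_or_nontrivial A with _ | _
  · exact ⟨0, fun x => .inl (Subsingleton.elim _ _)⟩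
  have : IsDomain A := NoZeroDivisors.to_isDomain A
  let _ : Field A := (Finite.isDomain_to_isField A).toField
  obtain ⟨g, hg⟩ := IsCyclic.exists_generator (α := Aˣ)
  refine ⟨g, fun x => or_iff_not_imp_left.mpr fun hx => ?_⟩
  obtain ⟨k, hk⟩ := mem_powers_iff_mem_zpowers.mpr (hg (Units.mk0 x hx))
  exact ⟨k, by simpa using (congrArg Units.val hk).symm⟩

/-- Nakayama's lemma for a module `M ⊆ N + 𝔭 M` in an ambient module. -/
theorem Submodule.exists_sub_one_mem_and_smul_mem_of_le_sup_smul {R V : Type*} [CommRing R]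
    [AddCommGroup V] [Module R V] (𝔭 : Ideal R) {M N : Submodule R V} (hM : M.FG)
    (hle : M ≤ N ⊔ 𝔭 • M) : ∃ r : R, r - 1 ∈ 𝔭 ∧ ∀ x ∈ M, r • x ∈ N := by
  obtain ⟨r, hr, hrM⟩ := Submodule.exists_sub_one_mem_and_smul_eq_zero_of_fg_of_le_smul 𝔭
    (M.map N.mkQ) (hM.map _) (by
      rw [← Submodule.map_smul'']
      refine (Submodule.map_mono hle).trans ?_
      rw [Submodule.map_sup, Submodule.mkQ_map_self, bot_sup_eq])
  refine ⟨r, hr, fun x hx => ?_⟩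
  have := hrM _ ⟨x, hx, rfl⟩
  rwa [← map_smul, Submodule.mkQ_apply, Submodule.Quotient.mk_eq_zero] at this

section Residue

variable {K : Type*} [Field K] {Q : Type*} [Ring Q] [Algebra K Q] [Algebra (𝓞 K) Q]
  [IsScalarTower (𝓞 K) K Q]

theorem smul_eq_centralModule_mul (𝔭 : Ideal (𝓞 K)) (M : Submodule (𝓞 K) Q) :
    𝔭 • M = centralModule Q ((𝔭 : FractionalIdeal (𝓞 K)⁰ K) : Submodule (𝓞 K) K) * M := by
  apply le_antisymm
  · refine Submodule.smul_le.mpr fun r hr x hx => ?_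
    rw [← IsScalarTower.algebraMap_smul K r, Algebra.smul_def]
    exact Submodule.mul_mem_mul
      (algebraMap_mem_centralModule (FractionalIdeal.mem_coeIdeal_of_mem _ hr)) hx
  · refine Submodule.mul_le.mpr ?_
    rintro _ ⟨b, hb, rfl⟩ x hx
    obtain ⟨r, hr, rfl⟩ := (FractionalIdeal.mem_coeIdeal _).mp hb
    change algebraMap K Q (algebraMap (𝓞 K) K r) * x ∈ 𝔭 • M
    rw [← Algebra.smul_def, IsScalarTower.algebraMap_smul]
    exact Submodule.smul_mem_smul hr hx

theorem Subalgebra.mul_smul_toSubmodule_le (𝔭 : Ideal (𝓞 K)) (O : Subalgebra (𝓞 K) Q) :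
    O.toSubmodule * (𝔭 • O.toSubmodule) ≤ 𝔭 • O.toSubmodule := by
  rw [smul_eq_centralModule_mul, ← mul_assoc, ← centralModule_mul_comm, mul_assoc]
  exact mul_le_mul' le_rfl (Submodule.mul_le.mpr fun _ hx _ hy => O.mul_mem hx hy)

theorem Subalgebra.smul_toSubmodule_mul_le (𝔭 : Ideal (𝓞 K)) (O : Subalgebra (𝓞 K) Q) :
    (𝔭 • O.toSubmodule) * O.toSubmodule ≤ 𝔭 • O.toSubmodule := by
  rw [smul_eq_centralModule_mul, mul_assoc]
  exact mul_le_mul' le_rfl (Submodule.mul_le.mpr fun _ hx _ hy => O.mul_mem hx hy)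

/-- The two-sided ideal `𝔭 O` of a `ℤ_K`-subalgebra `O` of `Q`. -/
def residueIdeal (𝔭 : Ideal (𝓞 K)) (O : Subalgebra (𝓞 K) Q) : Ideal O where
  carrier := {x | (x : Q) ∈ 𝔭 • O.toSubmodule}
  add_mem' := fun hx hy => (𝔭 • O.toSubmodule).add_mem hx hy
  zero_mem' := (𝔭 • O.toSubmodule).zero_mem
  smul_mem' := fun a _ hx => O.mul_smul_toSubmodule_le 𝔭 (Submodule.mul_mem_mul a.2 hx)

theorem mem_residueIdeal {𝔭 : Ideal (𝓞 K)} {O : Subalgebra (𝓞 K) Q} {x : O} :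
    x ∈ residueIdeal 𝔭 O ↔ (x : Q) ∈ 𝔭 • O.toSubmodule :=
  Iff.rfl

instance (𝔭 : Ideal (𝓞 K)) (O : Subalgebra (𝓞 K) Q) : (residueIdeal 𝔭 O).IsTwoSided where
  mul_mem_of_left := fun b hx =>
    O.smul_toSubmodule_mul_le 𝔭 (Submodule.mul_mem_mul (mem_residueIdeal.mp hx) b.2)

theorem finite_quotient_residueIdeal [NumberField K] {𝔭 : Ideal (𝓞 K)} (h𝔭 : 𝔭 ≠ ⊥)
    {O : Subalgebra (𝓞 K) Q} (hO : IsOrder O) : Finite (O ⧸ residueIdeal 𝔭 O) := by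
  have : Module.Finite (𝓞 K) O := Module.Finite.of_fg hO.fg
  have : Module.Finite ℤ O := Module.Finite.trans (𝓞 K) O
  have : Module.Finite ℤ (O ⧸ residueIdeal 𝔭 O) :=
    Module.Finite.of_surjective
      (Ideal.Quotient.mk (residueIdeal 𝔭 O)).toAddMonoidHom.toIntLinearMap
      Ideal.Quotient.mk_surjective
  refine Module.finite_of_fg_torsion _ fun {x} => ?_
  obtain ⟨y, rfl⟩ := Ideal.Quotient.mk_surjective x
  have hN : (Ideal.absNorm 𝔭 : ℤ) ≠ 0 := by
    simpa [Ideal.absNorm_eq_zero_iff] using h𝔭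
  refine ⟨⟨Ideal.absNorm 𝔭, mem_nonZeroDivisors_of_ne_zero hN⟩, ?_⟩
  change (Ideal.absNorm 𝔭 : ℤ) • Ideal.Quotient.mk (residueIdeal 𝔭 O) y = 0
  rw [← map_zsmul, Ideal.Quotient.eq_zero_iff_mem, mem_residueIdeal]
  have := Submodule.smul_mem_smul (Ideal.absNorm_mem 𝔭) y.2 (N := O.toSubmodule)
  simpa [Nat.cast_smul_eq_nsmul] using this

end Residue

namespace IsAnisotropicNormForm

variable {K : Type*} [Field K] [NumberField K] {Q : Type*} [Ring Q] [Nontrivial Q] [Algebra K Q]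
  [Algebra (𝓞 K) Q] [IsScalarTower (𝓞 K) K Q] [StarRing Q] {n : QuadraticForm K Q}
  (h : IsAnisotropicNormForm n)

include h

theorem pow_mem_span_pair {O : Subalgebra (𝓞 K) Q} (hO : IsOrder O) {g : Q} (hg : g ∈ O) (k : ℕ) :
    g ^ k ∈ Submodule.span (𝓞 K) {1, g} := by
  obtain ⟨t, ht⟩ := Submodule.mem_one.mp (h.trace_mem_one_of_mem_order hO hg)
  obtain ⟨m, hm⟩ := Submodule.mem_one.mp
    (latticeNorm_le_iff.mp (h.latticeNorm_order_le_one hO) g hg)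
  have hgg : g * g = t • g - m • (1 : Q) := by
    rw [h.mul_self_eq, ← ht, ← hm, IsScalarTower.algebraMap_smul,
      ← IsScalarTower.algebraMap_apply, Algebra.algebraMap_eq_smul_one]
  induction k with
  | zero => simpa using Submodule.subset_span (by simp)
  | succ k ih =>
    obtain ⟨a, b, hab⟩ := Submodule.mem_span_pair.mp ih
    rw [pow_succ, ← hab, add_mul, smul_mul_assoc, smul_mul_assoc, one_mul, hgg]
    refine Submodule.mem_span_pair.mpr ⟨-(b * m), a + b * t, ?_⟩
    module

/-- If `dim Q > 2`, then `O / 𝔭 O` has zero divisors for a prime `𝔭`. Otherwise this finite ring would be a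
field consisting of `0` and the powers of one element `g`, which lie in the span of `1` and `g`. By
Nakayama's lemma, `Q` would then be spanned by `1` and a lift of `g`. -/
theorem not_noZeroDivisors_residue {O : Subalgebra (𝓞 K) Q} (hO : IsOrder O)
    (hdim : 2 < Module.finrank K Q) {𝔭 : Ideal (𝓞 K)} (h𝔭 : 𝔭 ≠ ⊥) (h𝔭' : 𝔭 ≠ ⊤) :
    ¬ NoZeroDivisors (O ⧸ residueIdeal 𝔭 O) := by
  intro hdom
  have := finite_quotient_residueIdeal h𝔭 hO
  obtain ⟨g, hg⟩ := exists_forall_eq_zero_or_eq_pow (O ⧸ residueIdeal 𝔭 O)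
  obtain ⟨g, rfl⟩ := Ideal.Quotient.mk_surjective g
  have hle : O.toSubmodule ≤ Submodule.span (𝓞 K) {1, (g : Q)} ⊔ 𝔭 • O.toSubmodule := by
    intro x hx
    rcases hg (Ideal.Quotient.mk _ ⟨x, hx⟩) with h0 | ⟨k, hk⟩
    · exact Submodule.mem_sup_right (mem_residueIdeal.mp (Ideal.Quotient.eq_zero_iff_mem.mp h0))
    · rw [← _root_.map_pow, Ideal.Quotient.eq] at hk
      rw [← add_sub_cancel ((g : Q) ^ k) x]
      exact Submodule.add_mem_sup (h.pow_mem_span_pair hO g.2 k) hk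
  obtain ⟨r, hr, hrO⟩ := Submodule.exists_sub_one_mem_and_smul_mem_of_le_sup_smul 𝔭 hO.fg hle
  have hr0 : r ≠ 0 := by
    rintro rfl
    exact h𝔭' ((Ideal.eq_top_iff_one 𝔭).mpr (by simpa using hr))
  have htop : Submodule.span K {1, (g : Q)} = ⊤ := by
    rw [eq_top_iff, ← hO.span_eq_top, Submodule.span_le]
    intro x hx
    have hx' := Submodule.span_le_restrictScalars (𝓞 K) K _ (hrO x hx)
    rw [← IsScalarTower.algebraMap_smul K r] at hx'
    exact (Submodule.smul_mem_iff _ (by simpa using hr0)).mp hx'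
  have hcard : Module.finrank K (Submodule.span K {1, (g : Q)}) ≤ 2 := by
    classical
    refine (finrank_span_le_card _).trans ?_
    simpa using Finset.card_le_two
  rw [htop, finrank_top] at hcard
  omega

/-- For a maximal ideal `𝔭` there is a left ideal `P` of `O` with `𝔭 O ⊊ P` whose norms lie in `𝔭`:
the annihilator of a zero divisor of `O / 𝔭 O`. If `n x = star x * x` were a unit modulo `𝔭` for some
`x ∈ P`, then `P` would contain `1`. -/
theorem exists_leftIdeal {O : Subalgebra (𝓞 K) Q} (hO : IsOrder O)
    (hdim : 2 < Module.finrank K Q) {𝔭 : Ideal (𝓞 K)} (h𝔭 : 𝔭 ≠ ⊥) (hmax : 𝔭.IsMaximal) :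
    ∃ P : Submodule (𝓞 K) Q, P ≤ O.toSubmodule ∧ O.toSubmodule * P ≤ P ∧ 𝔭 • O.toSubmodule ≤ P ∧
      ¬ P ≤ 𝔭 • O.toSubmodule ∧
      latticeNorm n P ≤ ((𝔭 : FractionalIdeal (𝓞 K)⁰ K) : Submodule (𝓞 K) K) := by
  have hdom := h.not_noZeroDivisors_residue hO hdim h𝔭 hmax.ne_top
  obtain ⟨x, y, hx, hy, hxy⟩ : ∃ x y : O, x ∉ residueIdeal 𝔭 O ∧ y ∉ residueIdeal 𝔭 O ∧
      x * y ∈ residueIdeal 𝔭 O := by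
    by_contra! hcon
    refine hdom ⟨fun {a b} hab => ?_⟩
    obtain ⟨x, rfl⟩ := Ideal.Quotient.mk_surjective a
    obtain ⟨y, rfl⟩ := Ideal.Quotient.mk_surjective b
    rw [← _root_.map_mul] at hab
    simp only [Ideal.Quotient.eq_zero_iff_mem] at hab ⊢
    by_contra! hne
    exact hcon x y hne.1 hne.2 hab
  set M := 𝔭 • O.toSubmodule with hM
  have hOM : O.toSubmodule * M ≤ M := O.mul_smul_toSubmodule_le 𝔭
  have hMO : M * O.toSubmodule ≤ M := O.smul_toSubmodule_mul_le 𝔭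
  have hMleO : M ≤ O.toSubmodule :=
    Submodule.smul_le.mpr fun r _ x hx => O.toSubmodule.smul_mem r hx
  let P : Submodule (𝓞 K) Q :=
    O.toSubmodule ⊓ M.comap (LinearMap.mulRight (𝓞 K) (y : Q))
  have hMP : M ≤ P := le_inf hMleO fun z hz => hMO (Submodule.mul_mem_mul hz y.2)
  have hOP : O.toSubmodule * P ≤ P := Submodule.mul_le.mpr fun a ha z hz => by
    refine ⟨O.mul_mem ha hz.1, ?_⟩
    change a * z * y ∈ M
    rw [mul_assoc]
    exact hOM (Submodule.mul_mem_mul ha hz.2)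
  refine ⟨P, inf_le_left, hOP, hMP, fun hle => hx (hle ⟨x.2, hxy⟩), ?_⟩
  refine latticeNorm_le_iff.mpr fun z hz => ?_
  obtain ⟨m, hm⟩ := Submodule.mem_one.mp
    (latticeNorm_le_iff.mp (h.latticeNorm_order_le_one hO) z hz.1)
  rw [← hm]
  refine FractionalIdeal.mem_coeIdeal_of_mem _ ?_
  by_contra hmp
  obtain ⟨r, s, hs, hrs⟩ := hmax.exists_inv hmp
  have hone : (1 : Q) ∈ P := by
    have hmP : m • (1 : Q) ∈ P := by
      have := hOP (Submodule.mul_mem_mul (h.star_mem_of_mem_order hO hz.1) hz)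
      rwa [h.star_mul_self, ← hm, ← IsScalarTower.algebraMap_apply,
        Algebra.algebraMap_eq_smul_one] at this
    rw [← one_smul (𝓞 K) (1 : Q), ← hrs, add_smul, mul_smul]
    exact add_mem (P.smul_mem r hmP) (hMP (Submodule.smul_mem_smul hs O.one_mem))
  have hyM : (1 : Q) * y ∈ M := hone.2
  rw [one_mul] at hyM
  exact hy hyM

end IsAnisotropicNormForm

/-! ### Normal lattices and maximal lattices -/

namespace IsAnisotropicNormForm

variable {K : Type*} [Field K] [NumberField K] {Q : Type*} [Ring Q] [Nontrivial Q] [Algebra K Q]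
  [Algebra (𝓞 K) Q] [IsScalarTower (𝓞 K) K Q] [StarRing Q] {n : QuadraticForm K Q}
  (h : IsAnisotropicNormForm n)

include h

/-- If `L ⊇ J` satisfies `n(L) ⊆ 𝔞 = n(J)`, then `𝔞 L ⊆ J (star J) L ⊆ J 𝔞 O = 𝔞 J` for the right
order `O` of `J`, so `L = J`. -/
theorem isMaximalLattice_of_isNormalLattice {J : Submodule (𝓞 K) Q} (hJ : IsNormalLattice J)
    {𝔞 : FractionalIdeal (𝓞 K)⁰ K} (hJ𝔞 : latticeNorm n J = 𝔞) : IsMaximalLattice n 𝔞 J := by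
  refine ⟨hJ.1, latticeNorm_le_iff.mp hJ𝔞.le, fun L hL hlt hL𝔞 => ?_⟩
  have hL𝔞' : latticeNorm n L ≤ 𝔞 := latticeNorm_le_iff.mpr hL𝔞
  have h𝔞 := h.coe_ne_zero_of_latticeNorm_le hL hL𝔞'
  have hLO := h.conjModule_mul_le_of_isNormalLattice hJ hL hlt.le hJ𝔞 hL𝔞'
  set C := centralModule Q (𝔞 : Submodule (𝓞 K) K) with hC
  set C' := centralModule Q ((𝔞⁻¹ : FractionalIdeal (𝓞 K)⁰ K) : Submodule (𝓞 K) K) with hC'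
  have hC'C : C' * C = 1 := by rw [centralModule_mul_comm, centralModule_coe_mul_inv h𝔞]
  refine hlt.not_ge ?_
  calc L = C' * (C * L) := by rw [← mul_assoc, hC'C, one_mul]
    _ ≤ C' * (J * h.conjModule J * L) := by
        refine mul_le_mul' le_rfl (mul_le_mul' ?_ le_rfl)
        rw [hC, ← hJ𝔞]
        exact h.centralModule_latticeNorm_le' J
    _ ≤ C' * (J * (C * (rightOrder J).toSubmodule)) := by
        rw [mul_assoc]
        exact mul_le_mul' le_rfl (mul_le_mul' le_rfl
          ((mul_le_mul' (h.conjModule_mono hlt.le) le_rfl).trans hLO))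
    _ = J * (rightOrder J).toSubmodule := by
        rw [← mul_assoc J, ← centralModule_mul_comm, mul_assoc, ← mul_assoc C', hC'C, one_mul]
    _ ≤ J := mul_rightOrder_le J

/-- Let `O` be a maximal order containing `𝔞⁻¹ (star J) J`. The lattice `J O` still has norm in `𝔞`,
so `J O = J` by maximality, and `O` is the right order of `J`. -/
theorem isNormalLattice_of_isMaximalLattice [FiniteDimensional K Q] {J : Submodule (𝓞 K) Q}
    {𝔞 : FractionalIdeal (𝓞 K)⁰ K} (hJ : IsMaximalLattice n 𝔞 J) : IsNormalLattice J := by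
  obtain ⟨hJL, hJ𝔞, hmax⟩ := hJ
  have hJ𝔞' : latticeNorm n J ≤ 𝔞 := latticeNorm_le_iff.mpr hJ𝔞
  obtain ⟨Λ, hΛ, hJΛ⟩ := h.exists_order_conjModule_mul_le hJL hJ𝔞'
  obtain ⟨O, hO, hΛO⟩ := h.exists_isMaximalOrder_ge hΛ
  have hle : J ≤ J * O.toSubmodule := O.le_mul_toSubmodule J
  have hn : latticeNorm n (J * O.toSubmodule) ≤ 𝔞 := by
    have := h.latticeNorm_mul_le (O := O.toSubmodule) (I := O.toSubmodule) hJ𝔞'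
      (hJΛ.trans (mul_le_mul' le_rfl (Subalgebra.toSubmodule.le_iff_le.mpr hΛO)))
      (Submodule.mul_le.mpr fun _ hx _ hy => O.mul_mem hx hy) (h.latticeNorm_order_le_one hO.1)
    rwa [mul_one] at this
  have hLat : (J * O.toSubmodule).IsLattice K :=
    Submodule.IsLattice.of_le_of_isLattice_of_fg K hle (hJL.fg.mul hO.1.fg)
  have hJO : J * O.toSubmodule ≤ J := by
    by_contra hnle
    exact hmax _ hLat (lt_of_le_not_ge hle hnle) (latticeNorm_le_iff.mp hn)
  have hOr : O ≤ rightOrder J :=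
    Subalgebra.toSubmodule.le_iff_le.mp (le_rightOrder_of_mul_le hJO)
  have hr : IsOrder (rightOrder J) := by
    have : O.toSubmodule.IsLattice K := hO.1
    exact Submodule.IsLattice.of_le_of_isLattice_of_fg K (M := O.toSubmodule) hOr
      (rightOrder_fg hJL)
  refine ⟨hJL, ?_⟩
  rw [hO.2 _ hr hOr]
  exact hO

/-- An `𝔞`-maximal lattice `J` has norm `𝔞`. Otherwise `n(J) ⊆ 𝔭 𝔞` for some prime `𝔭`; for a left
ideal `P ⊋ 𝔭 O` of the right order `O` of `J` with `n(P) ⊆ 𝔭`, the lattice `J (𝔭⁻¹ P) ⊋ J` has norm in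
`n(J) 𝔭⁻² 𝔭 ⊆ 𝔞`. -/
theorem latticeNorm_eq_of_isMaximalLattice (hdim : 2 < Module.finrank K Q)
    {J : Submodule (𝓞 K) Q} {𝔞 : FractionalIdeal (𝓞 K)⁰ K} (hJ : IsMaximalLattice n 𝔞 J) :
    latticeNorm n J = 𝔞 := by
  have : FiniteDimensional K Q := Module.finite_of_finrank_pos (by omega)
  have hN := h.isNormalLattice_of_isMaximalLattice hJ
  obtain ⟨hJL, hJ𝔞, hmax⟩ := hJ
  have hJ𝔞' : latticeNorm n J ≤ 𝔞 := latticeNorm_le_iff.mpr hJ𝔞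
  have h𝔞 := h.coe_ne_zero_of_latticeNorm_le hJL hJ𝔞'
  obtain ⟨𝔟, h𝔟⟩ : ∃ 𝔟 : FractionalIdeal (𝓞 K)⁰ K, latticeNorm n J = 𝔟 :=
    ⟨⟨_, FractionalIdeal.isFractional_of_fg (h.latticeNorm_fg hJL.fg)⟩, rfl⟩
  rw [h𝔟] at hJ𝔞' ⊢
  by_contra hne
  have h𝔟0 := h.coe_ne_zero_of_latticeNorm_le hJL h𝔟.le
  -- A maximal ideal `𝔭` containing the proper integral ideal `n(J) 𝔞⁻¹`.
  obtain ⟨𝔭, hpmax, hp0, hp⟩ : ∃ 𝔭 : Ideal (𝓞 K), 𝔭.IsMaximal ∧ 𝔭 ≠ ⊥ ∧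
      𝔟 ≤ (𝔭 : FractionalIdeal (𝓞 K)⁰ K) * 𝔞 := by
    have hle1 : 𝔟 * 𝔞⁻¹ ≤ 1 := by
      rw [← mul_inv_cancel₀ h𝔞]
      exact mul_le_mul' hJ𝔞' le_rfl
    obtain ⟨𝔠, h𝔠⟩ := FractionalIdeal.le_one_iff_exists_coeIdeal.mp hle1
    have h𝔟𝔠 : 𝔟 = 𝔠 * 𝔞 := by rw [h𝔠, mul_assoc, inv_mul_cancel₀ h𝔞, mul_one]
    have h𝔠1 : 𝔠 ≠ ⊤ := by
      rintro rfl
      refine hne ?_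
      rw [h𝔟𝔠, FractionalIdeal.coeIdeal_top, one_mul]
    obtain ⟨𝔭, hpmax, hle⟩ := Ideal.exists_le_maximal 𝔠 h𝔠1
    refine ⟨𝔭, hpmax, ?_, ?_⟩
    · rintro rfl
      refine h𝔟0 ?_
      rw [h𝔟𝔠, le_bot_iff.mp hle, FractionalIdeal.coeIdeal_bot, zero_mul]
    · rw [h𝔟𝔠]
      exact mul_le_mul' ((FractionalIdeal.coeIdeal_le_coeIdeal K).mpr hle) le_rfl
  set O := rightOrder J with hO
  obtain ⟨P, hPO, hOP, hpP, hnP, hP⟩ := h.exists_leftIdeal hN.2.1 hdim hp0 hpmax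
  rw [smul_eq_centralModule_mul] at hpP hnP
  set 𝔮 : FractionalIdeal (𝓞 K)⁰ K := (𝔭 : FractionalIdeal (𝓞 K)⁰ K)
  have hq0 : 𝔮 ≠ 0 := FractionalIdeal.coeIdeal_ne_zero.mpr hp0
  set C := centralModule Q (𝔮 : Submodule (𝓞 K) K) with hC
  set C' := centralModule Q ((𝔮⁻¹ : FractionalIdeal (𝓞 K)⁰ K) : Submodule (𝓞 K) K) with hC'
  have hCC' : C * C' = 1 := centralModule_coe_mul_inv hq0
  have hC'C : C' * C = 1 := by rw [centralModule_mul_comm, hCC']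
  -- `n(𝔭⁻¹ P) ⊆ 𝔭⁻² 𝔭`, as the norm of the product of the central module `𝔭⁻¹` with `P`.
  have hnC' : latticeNorm n C' ≤
      ((𝔮⁻¹ * 𝔮⁻¹ : FractionalIdeal (𝓞 K)⁰ K) : Submodule (𝓞 K) K) := by
    refine latticeNorm_le_iff.mpr ?_
    rintro _ ⟨b, hb, rfl⟩
    change n (algebraMap K Q b) ∈ _
    rw [h.map_algebraMap, FractionalIdeal.coe_mul]
    exact Submodule.mul_mem_mul hb hb
  have hconjC' : h.conjModule C' * C' ≤
      centralModule Q ((𝔮⁻¹ * 𝔮⁻¹ : FractionalIdeal (𝓞 K)⁰ K) : Submodule (𝓞 K) K) * 1 := by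
    rw [mul_one, FractionalIdeal.coe_mul, centralModule_mul]
    refine mul_le_mul' ?_ le_rfl
    rintro _ ⟨_, ⟨b, hb, rfl⟩, rfl⟩
    exact ⟨b, hb, (h.star_algebraMap b).symm⟩
  have hnI : latticeNorm n (C' * P) ≤ ((𝔮⁻¹ : FractionalIdeal (𝓞 K)⁰ K) : Submodule (𝓞 K) K) := by
    have := h.latticeNorm_mul_le hnC' hconjC' (one_mul P).le hP
    rwa [← FractionalIdeal.coe_mul, mul_assoc, inv_mul_cancel₀ hq0, mul_one] at this
  have hOI : O.toSubmodule * (C' * P) ≤ C' * P := by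
    rw [← mul_assoc, ← centralModule_mul_comm, mul_assoc]
    exact mul_le_mul' le_rfl hOP
  have hnJI : latticeNorm n (J * (C' * P)) ≤ 𝔞 := by
    have := h.latticeNorm_mul_le h𝔟.le
      (h.conjModule_mul_le_of_isNormalLattice hN hJL le_rfl h𝔟 h𝔟.le) hOI hnI
    rw [← FractionalIdeal.coe_mul] at this
    refine this.trans (?_ : 𝔟 * 𝔮⁻¹ ≤ 𝔞)
    calc 𝔟 * 𝔮⁻¹ ≤ 𝔮 * 𝔞 * 𝔮⁻¹ := mul_le_mul' hp le_rfl
      _ = 𝔞 := by rw [mul_comm 𝔮, mul_assoc, mul_inv_cancel₀ hq0, mul_one]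
  -- `J 𝔭⁻¹ P ⊇ J`, since `𝔭⁻¹ P ⊇ 𝔭⁻¹ 𝔭 O = O`; so both are equal by maximality of `J`.
  have hOleI : O.toSubmodule ≤ C' * P := by
    calc O.toSubmodule = C' * (C * O.toSubmodule) := by rw [← mul_assoc, hC'C, one_mul]
      _ ≤ C' * P := mul_le_mul' le_rfl hpP
  have hle : J ≤ J * (C' * P) := (O.le_mul_toSubmodule J).trans (mul_le_mul' le_rfl hOleI)
  have hLat : (J * (C' * P)).IsLattice K :=
    Submodule.IsLattice.of_le_of_isLattice_of_fg K hle
      (hJL.fg.mul ((centralModule_coe_fg _).mul (hN.2.1.fg.of_le hPO)))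
  have hJI : J * (C' * P) ≤ J := by
    by_contra hnle
    exact hmax _ hLat (lt_of_le_not_ge hle hnle) (latticeNorm_le_iff.mp hnJI)
  -- Hence `𝔭⁻¹ P` is contained in the right order `O`, contrary to the choice of `P`.
  refine hnP ?_
  calc P = C * (C' * P) := by rw [← mul_assoc, hCC', one_mul]
    _ ≤ C * O.toSubmodule := mul_le_mul' le_rfl (le_rightOrder_of_mul_le hJI)

end IsAnisotropicNormForm

/-! ### Totally definite quaternion algebras -/

section Quaternion

variable {K : Type*} [Field K] {a b : K}

/-- Under a real embedding the norm form becomes positive definite. -/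
theorem reducedNorm_anisotropic (σ : K →+* ℝ) (ha : 0 < σ a) (hb : 0 < σ b) :
    (reducedNorm (-a) (-b)).Anisotropic := by
  intro x hx
  have hx' : x.re ^ 2 + a * x.imI ^ 2 + b * x.imJ ^ 2 + a * b * x.imK ^ 2 = 0 := by
    refine Eq.trans ?_ hx
    change _ = (x * star x).re
    simp
    ring
  have hσ := congrArg σ hx'
  simp only [map_add, map_mul, map_pow, map_zero] at hσ
  have h1 : 0 ≤ σ x.re ^ 2 := by positivity
  have h2 : 0 ≤ σ a * σ x.imI ^ 2 := by positivity
  have h3 : 0 ≤ σ b * σ x.imJ ^ 2 := by positivity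
  have h4 : 0 ≤ σ a * σ b * σ x.imK ^ 2 := by positivity
  have e1 : σ x.re ^ 2 = 0 := by linarith
  have e2 : σ a * σ x.imI ^ 2 = 0 := by linarith
  have e3 : σ b * σ x.imJ ^ 2 = 0 := by linarith
  have e4 : σ a * σ b * σ x.imK ^ 2 = 0 := by linarith
  simp only [mul_eq_zero, pow_eq_zero_iff, ne_eq, OfNat.ofNat_ne_zero, not_false_eq_true, ha.ne',
    hb.ne', false_or, map_eq_zero] at e1 e2 e3 e4
  ext <;> simpa

theorem isAnisotropicNormForm_reducedNorm (σ : K →+* ℝ) (ha : 0 < σ a) (hb : 0 < σ b) :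
    IsAnisotropicNormForm (reducedNorm (-a) (-b)) where
  star_algebraMap r := by
    rw [QuaternionAlgebra.algebraMap_eq]
    ext <;> simp
  mul_star x := (coe_reducedNorm (-a) (-b) x).symm
  anisotropic := reducedNorm_anisotropic σ ha hb

end Quaternion

/-- `Q = ℍ[K, -a, -b]` with `K` totally real and `a, b` totally positive is the general totally
definite quaternion algebra over a number field. -/
theorem mainTheorem5 (K : Type*) [Field K] [NumberField K] [NumberField.IsTotallyReal K]
    (a b : K) (ha : IsTotallyPositive a) (hb : IsTotallyPositive b)
    (J : Submodule (𝓞 K) ℍ[K, -a, -b]) (hJ : J.IsLattice K)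
    (𝔞 : FractionalIdeal (𝓞 K)⁰ K) :
    (IsNormalLattice J ∧ latticeNorm (reducedNorm (-a) (-b)) J = (𝔞 : Submodule (𝓞 K) K)) ↔
      J ∈ maximalLattices (reducedNorm (-a) (-b)) 𝔞 := by
  obtain ⟨w⟩ := (inferInstance : Nonempty (NumberField.InfinitePlace K))
  have hw : w.IsReal := NumberField.IsTotallyReal.isReal w
  have h := isAnisotropicNormForm_reducedNorm (NumberField.InfinitePlace.embedding_of_isReal hw)
    (ha _) (hb _)
  have hdim : 2 < Module.finrank K ℍ[K, -a, -b] := by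
    rw [QuaternionAlgebra.finrank_eq_four]
    norm_num
  have : FiniteDimensional K ℍ[K, -a, -b] := Module.finite_of_finrank_pos (by omega)
  constructor
  · rintro ⟨hN, hn⟩
    exact h.isMaximalLattice_of_isNormalLattice hN hn
  · intro hM
    exact ⟨h.isNormalLattice_of_isMaximalLattice hM, h.latticeNorm_eq_of_isMaximalLattice hdim hM⟩
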